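/- Let $\alpha\in(0,1]$ and let $F_\alpha:[0,\infty)\to\mathbb R$ be the solution of the initial value problem $$F_\alpha'(x)=1-F_\alpha(x)^\alpha\quad(x\ge 0),\qquad F_\alpha(0)=0$$ (at $x=0$ the derivative is the right derivative; this solution exists and is unique). Then there is a positive measure $\sigma_\alpha$ on $[0,\infty)$ with $\sigma_\alpha([0,\infty))=1-F_\alpha(0)=1$, that is, a probability measure, such that $$1-F_\alpha(x)=\int_0^{\infty}e^{-xt}\,d\sigma_\alpha(t)\qquad\text{for all }x\ge 0.$$ -/

import Mathlib

open MeasureTheory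
open scoped NNReal

/-- `F` solves, on the half-line `[0, ∞)`, the initial value problem
`F'(x) = 1 - F(x) ^ α`, `F(0) = 0` (at `x = 0` the derivative is the right derivative).
Only the values of `F` on `[0, ∞)` matter. -/
structure IsProfileFunction (α : ℝ) (F : ℝ → ℝ) : Prop where
  map_zero : F 0 = 0
  hasDeriv : ∀ x : ℝ, 0 ≤ x → HasDerivWithinAt F (1 - F x ^ α) (Set.Ici 0) x

/-!
A solution rises from `0` towards the equilibrium `1`, and `u = 1 - F` is completely monotone: the
functions `F ^ (-b) * (1 - F ^ α) ^ j` with `0 ≤ b` have derivative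
`-(b F ^ (-(b + 1)) (1 - F ^ α) ^ (j + 1) + j α F ^ (-(b + 1 - α)) (1 - F ^ α) ^ j)`, so, as
`α ≤ 1`, the cone they span consists of nonnegative functions and is stable under `-d/dx`; and
`-u' = 1 - F ^ α` lies in it.

The representing measure comes from Bernstein's theorem. For a completely monotone `f` with
`f 0 = 1` and each `a > 0`, the Taylor series of `f` at `a` exhibits `s ↦ f (a (1 - s))` as the
generating function of a probability distribution on `ℕ`. Placing its `k`-th weight at `k / a`
gives a measure with Laplace transform `f (a (1 - exp (-x / a)))`, which tends to `f x` as
`a → ∞`; these measures are tight, and any limit point represents `f`.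
-/

open Filter Topology Set
open scoped ContDiff

/-! ### Completely monotone functions -/

/-- Complete monotonicity on the open half-line `(0, ∞)`. The behaviour at `0` is left free; a
finite limit there is what makes the representing measure of Bernstein's theorem finite. -/
structure CompletelyMonotone (f : ℝ → ℝ) : Prop where
  contDiffOn : ContDiffOn ℝ ∞ f (Ioi 0)
  neg_one_pow_mul_iteratedDeriv_nonneg :
    ∀ (n : ℕ) (x : ℝ), 0 < x → 0 ≤ (-1) ^ n * iteratedDeriv n f x

namespace CompletelyMonotone

theorem of_mem_of_neg_deriv_mem {S : Set (ℝ → ℝ)} (hnonneg : ∀ f ∈ S, ∀ x > 0, 0 ≤ f x)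
    (hderiv : ∀ f ∈ S, ∃ g ∈ S, ∀ x > 0, HasDerivAt f (-g x) x) {f : ℝ → ℝ} (hf : f ∈ S) :
    CompletelyMonotone f := by
  have iteratedDeriv_eq : ∀ n, ∃ g ∈ S,
      EqOn (iteratedDeriv n f) (fun x => (-1) ^ n * g x) (Ioi 0) := by
    intro n
    induction n with
    | zero => exact ⟨f, hf, fun x _ => by simp⟩
    | succ n ih =>
      obtain ⟨g, hg, heq⟩ := ih
      obtain ⟨h, hh, hgh⟩ := hderiv g hg
      refine ⟨h, hh, fun x hx => ?_⟩
      have := ((hgh x hx).const_mul ((-1) ^ n)).congr_of_eventuallyEq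
        (heq.eventuallyEq_of_mem (Ioi_mem_nhds hx))
      rw [iteratedDeriv_succ, this.deriv]
      ring
  refine ⟨contDiffOn_of_differentiableOn_deriv fun n _ => ?_, fun n x hx => ?_⟩ <;>
    obtain ⟨g, hg, heq⟩ := iteratedDeriv_eq n
  · obtain ⟨h, -, hgh⟩ := hderiv g hg
    refine DifferentiableOn.congr (fun x hx => ?_)
      ((iteratedDerivWithin_of_isOpen isOpen_Ioi).trans heq)
    exact ((hgh x hx).const_mul _).differentiableAt.differentiableWithinAt
  · rw [heq hx, ← mul_assoc, ← mul_pow]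
    simpa using hnonneg g hg x hx

theorem of_mem_span_of_neg_deriv_mem_span {S : Set (ℝ → ℝ)} (hnonneg : ∀ f ∈ S, ∀ x > 0, 0 ≤ f x)
    (hderiv : ∀ f ∈ S, ∃ g ∈ Submodule.span ℝ≥0 S, ∀ x > 0, HasDerivAt f (-g x) x)
    {f : ℝ → ℝ} (hf : f ∈ Submodule.span ℝ≥0 S) : CompletelyMonotone f := by
  refine of_mem_of_neg_deriv_mem (S := Submodule.span ℝ≥0 S) (fun f hf => ?_) (fun f hf => ?_) hf
  · induction hf using Submodule.span_induction with
    | mem f hf => exact hnonneg f hf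
    | zero => exact fun _ _ => le_rfl
    | add f g _ _ ihf ihg => exact fun x hx => add_nonneg (ihf x hx) (ihg x hx)
    | smul c f _ ih => exact fun x hx => mul_nonneg c.2 (ih x hx)
  · induction hf using Submodule.span_induction with
    | mem f hf => exact hderiv f hf
    | zero => exact ⟨0, zero_mem _, fun x _ => by simp [Pi.zero_def, hasDerivAt_const]⟩
    | add f₁ f₂ _ _ ih₁ ih₂ =>
      obtain ⟨g₁, hg₁, h₁⟩ := ih₁
      obtain ⟨g₂, hg₂, h₂⟩ := ih₂
      refine ⟨g₁ + g₂, add_mem hg₁ hg₂, fun x hx => ?_⟩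
      rw [Pi.add_apply, neg_add]
      exact (h₁ x hx).add (h₂ x hx)
    | smul c f _ ih =>
      obtain ⟨g, hg, h⟩ := ih
      refine ⟨c • g, Submodule.smul_mem _ c hg, fun x hx => ?_⟩
      rw [Pi.smul_apply, ← smul_neg]
      exact (h x hx).const_smul c

end CompletelyMonotone

theorem exists_eq_sum_iteratedDeriv_add {f : ℝ → ℝ} {u : Set ℝ} (hu : IsOpen u) {n : ℕ}
    (hf : ContDiffOn ℝ (n + 1) f u) {x a : ℝ} (hxa : x < a) (hsub : Icc x a ⊆ u) :
    ∃ ξ ∈ Ioo x a, f x =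
      (∑ k ∈ Finset.range (n + 1), iteratedDeriv k f a / k.factorial * (x - a) ^ k) +
        iteratedDeriv (n + 1) f ξ * (x - ξ) ^ n / n.factorial * (x - a) := by
  have huIcc : uIcc a x = Icc x a := uIcc_of_ge hxa.le
  have huniq : UniqueDiffOn ℝ (uIcc a x) := huIcc ▸ uniqueDiffOn_Icc hxa
  have hf' : ContDiffOn ℝ (n + 1) f (uIcc a x) := hf.mono (huIcc ▸ hsub)
  have hiter : ∀ k ≤ n + 1,
      EqOn (iteratedDerivWithin k f (uIcc a x)) (iteratedDeriv k f) (uIcc a x) :=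
    fun k hk y hy => iteratedDerivWithin_eq_iteratedDeriv huniq
      ((hf.contDiffAt (hu.mem_nhds (hsub (huIcc ▸ hy)))).of_le (mod_cast hk)) hy
  obtain ⟨ξ, hξ, h⟩ := taylor_mean_remainder_cauchy (n := n) hxa.ne'
    (hf'.of_le (mod_cast n.le_succ))
    ((hf'.differentiableOn_iteratedDerivWithin (mod_cast n.lt_succ_self)
      huniq).mono uIoo_subset_uIcc_self)
  rw [hiter _ le_rfl (uIoo_subset_uIcc_self hξ), taylor_within_apply, sub_eq_iff_eq_add'] at h
  refine ⟨ξ, uIoo_of_ge hxa.le ▸ hξ, h.trans ?_⟩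
  congr 1
  refine Finset.sum_congr rfl fun k hk => ?_
  rw [hiter k (Finset.mem_range.1 hk).le left_mem_uIcc, smul_eq_mul]
  ring

/-- The coefficient of `s ^ k` in the Taylor expansion of `s ↦ f (a * (1 - s))` at `s = 0`. For a
completely monotone `f` with `f 0 = 1` these are the weights of a probability distribution on `ℕ`,
whose generating function is `s ↦ f (a * (1 - s))`. -/
noncomputable def taylorWeight (f : ℝ → ℝ) (a : ℝ) (k : ℕ) : ℝ :=
  (-a) ^ k / k.factorial * iteratedDeriv k f a

theorem exists_eq_sum_taylorWeight_add {f : ℝ → ℝ} {n : ℕ}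
    (hf : ContDiffOn ℝ (n + 1) f (Ioi 0)) {a s : ℝ} (ha : 0 < a) (hs0 : 0 < s) (hs1 : s < 1) :
    ∃ ξ ∈ Ioo (a * (1 - s)) a, f (a * (1 - s)) =
      (∑ k ∈ Finset.range (n + 1), taylorWeight f a k * s ^ k) +
        taylorWeight f ξ (n + 1) * ((n + 1) * (1 - a * (1 - s) / ξ) ^ n * (a * s / ξ)) := by
  have hpos : 0 < a * (1 - s) := mul_pos ha (sub_pos.2 hs1)
  obtain ⟨ξ, hξ, h⟩ := exists_eq_sum_iteratedDeriv_add isOpen_Ioi hf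
    (mul_lt_of_lt_one_right ha (sub_lt_self 1 hs0)) fun y hy => hpos.trans_le hy.1
  have hξ0 : ξ ≠ 0 := (hpos.trans hξ.1).ne'
  have hsub : a * (1 - s) - a = -a * s := by ring
  refine ⟨ξ, hξ, h.trans ?_⟩
  rw [hsub]
  congr 1
  · refine Finset.sum_congr rfl fun k _ => ?_
    rw [taylorWeight, mul_pow]
    ring
  · rw [taylorWeight, Nat.factorial_succ, one_sub_div hξ0, div_pow, neg_pow ξ,
      ← neg_sub ξ, neg_pow (ξ - _)]
    push_cast
    field_simp
    ring

namespace CompletelyMonotone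

variable {f : ℝ → ℝ} (hf : CompletelyMonotone f)

include hf

theorem antitoneOn : AntitoneOn f (Ioi 0) := by
  refine antitoneOn_of_deriv_nonpos (convex_Ioi 0) hf.contDiffOn.continuousOn ?_ fun x hx => ?_
  · rw [interior_Ioi]
    exact hf.contDiffOn.differentiableOn (by simp)
  · rw [interior_Ioi] at hx
    simpa using hf.neg_one_pow_mul_iteratedDeriv_nonneg 1 x hx

theorem taylorWeight_nonneg {a : ℝ} (ha : 0 < a) (k : ℕ) : 0 ≤ taylorWeight f a k := by
  rw [taylorWeight, neg_pow, mul_comm (_ ^ k), mul_div_right_comm, mul_assoc]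
  exact mul_nonneg (by positivity) (hf.neg_one_pow_mul_iteratedDeriv_nonneg k a ha)

theorem sum_taylorWeight_mul_pow_le {a s : ℝ} (ha : 0 < a) (hs0 : 0 < s) (hs1 : s < 1) (n : ℕ) :
    ∑ k ∈ Finset.range (n + 1), taylorWeight f a k * s ^ k ≤ f (a * (1 - s)) := by
  obtain ⟨ξ, hξ, h⟩ := exists_eq_sum_taylorWeight_add
    (hf.contDiffOn.of_le (mod_cast le_top)) ha hs0 hs1 (n := n)
  have hξ0 : 0 < ξ := (mul_pos ha (sub_pos.2 hs1)).trans hξ.1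
  have hle : a * (1 - s) / ξ ≤ 1 := (div_le_one hξ0).2 hξ.1.le
  rw [h]
  exact le_add_of_nonneg_right (mul_nonneg (hf.taylorWeight_nonneg hξ0 _)
    (mul_nonneg (mul_nonneg (by positivity) (pow_nonneg (sub_nonneg.2 hle) n)) (by positivity)))

theorem sum_taylorWeight_le {M a : ℝ} (hM : ∀ x > 0, f x ≤ M) (ha : 0 < a) (n : ℕ) :
    ∑ k ∈ Finset.range (n + 1), taylorWeight f a k ≤ M := by
  have hlim : Tendsto (fun s => ∑ k ∈ Finset.range (n + 1), taylorWeight f a k * s ^ k) (𝓝[<] 1)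
      (𝓝 (∑ k ∈ Finset.range (n + 1), taylorWeight f a k * 1 ^ k)) :=
    (Continuous.tendsto (by fun_prop) 1).mono_left nhdsWithin_le_nhds
  simp only [one_pow, mul_one] at hlim
  refine le_of_tendsto hlim ?_
  filter_upwards [Ioo_mem_nhdsLT one_pos] with s hs
  exact (hf.sum_taylorWeight_mul_pow_le ha hs.1 hs.2 n).trans
    (hM _ (mul_pos ha (sub_pos.2 hs.2)))

theorem hasSum_taylorWeight_mul_pow {M a s : ℝ} (hM : ∀ x > 0, f x ≤ M) (ha : 0 < a)
    (hs0 : 0 < s) (hs1 : s < 1) :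
    HasSum (fun k => taylorWeight f a k * s ^ k) (f (a * (1 - s))) := by
  have hx : 0 < a * (1 - s) := mul_pos ha (sub_pos.2 hs1)
  have remainder_le : ∀ n : ℕ, f (a * (1 - s)) - M * ((n + 1) * s ^ n * (s / (1 - s))) ≤
      ∑ k ∈ Finset.range (n + 1), taylorWeight f a k * s ^ k := by
    intro n
    obtain ⟨ξ, hξ, h⟩ := exists_eq_sum_taylorWeight_add
      (hf.contDiffOn.of_le (mod_cast le_top)) ha hs0 hs1 (n := n)
    have hξ0 : 0 < ξ := hx.trans hξ.1
    have hweight : taylorWeight f ξ (n + 1) ≤ M :=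
      (Finset.single_le_sum (fun k _ => hf.taylorWeight_nonneg hξ0 k)
        (Finset.self_mem_range_succ (n + 1))).trans (hf.sum_taylorWeight_le hM hξ0 (n + 1))
    have hbase0 : 0 ≤ 1 - a * (1 - s) / ξ := sub_nonneg.2 ((div_le_one hξ0).2 hξ.1.le)
    have hbase : 1 - a * (1 - s) / ξ ≤ s := by
      rw [sub_le_comm, le_div_iff₀ hξ0, mul_comm]
      exact mul_le_mul_of_nonneg_right hξ.2.le (sub_pos.2 hs1).le
    have hfactor : a * s / ξ ≤ s / (1 - s) := by
      rw [div_le_div_iff₀ hξ0 (sub_pos.2 hs1), mul_right_comm, mul_comm]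
      exact mul_le_mul_of_nonneg_left hξ.1.le hs0.le
    rw [sub_le_iff_le_add, h]
    have hM0 : 0 ≤ M := (hf.taylorWeight_nonneg hξ0 _).trans hweight
    gcongr
  have remainder_tendsto : Tendsto (fun n : ℕ => M * ((n + 1) * s ^ n * (s / (1 - s)))) atTop
      (𝓝 0) := by
    have h := ((tendsto_self_mul_const_pow_of_lt_one hs0.le hs1).add
      (tendsto_pow_atTop_nhds_zero_of_lt_one hs0.le hs1)).mul_const (s / (1 - s)) |>.const_mul M
    simpa [add_mul] using h
  rw [hasSum_iff_tendsto_nat_of_nonneg fun k =>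
      mul_nonneg (hf.taylorWeight_nonneg ha k) (pow_nonneg hs0.le k),
    ← tendsto_add_atTop_iff_nat 1]
  exact tendsto_of_tendsto_of_tendsto_of_le_of_le
    (by simpa using tendsto_const_nhds.sub remainder_tendsto) tendsto_const_nhds remainder_le
    (hf.sum_taylorWeight_mul_pow_le ha hs0 hs1)

theorem le_of_tendsto_nhdsGT_zero {M : ℝ} (hlim : Tendsto f (𝓝[>] 0) (𝓝 M)) {x : ℝ}
    (hx : 0 < x) : f x ≤ M :=
  ge_of_tendsto hlim <| by
    filter_upwards [Ioc_mem_nhdsGT hx] with y hy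
    exact hf.antitoneOn hy.1 hx hy.2

theorem hasSum_taylorWeight {M a : ℝ} (hlim : Tendsto f (𝓝[>] 0) (𝓝 M)) (ha : 0 < a) :
    HasSum (taylorWeight f a) M := by
  have hM : ∀ x > 0, f x ≤ M := fun x hx => hf.le_of_tendsto_nhdsGT_zero hlim hx
  have hsum : Summable (taylorWeight f a) :=
    summable_of_sum_range_le (hf.taylorWeight_nonneg ha) fun n =>
      (Finset.sum_le_sum_of_subset_of_nonneg (Finset.range_mono n.le_succ) fun k _ _ =>
        hf.taylorWeight_nonneg ha k).trans (hf.sum_taylorWeight_le hM ha n)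
  have habel := Real.tendsto_tsum_powerSeries_nhdsWithin_lt hsum.hasSum.tendsto_sum_nat
  have hzero : Tendsto (fun s => a * (1 - s)) (𝓝[<] 1) (𝓝[>] 0) := by
    refine tendsto_nhdsWithin_iff.2 ⟨Continuous.tendsto' (by fun_prop) _ _ (by simp) |>.mono_left
      nhdsWithin_le_nhds, ?_⟩
    filter_upwards [self_mem_nhdsWithin] with s hs using mul_pos ha (sub_pos.2 hs)
  have htsum : ∑' k, taylorWeight f a k = M := by
    refine tendsto_nhds_unique habel ((hlim.comp hzero).congr' ?_)
    filter_upwards [Ioo_mem_nhdsLT one_pos] with s hs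
    exact (hf.hasSum_taylorWeight_mul_pow hM ha hs.1 hs.2).tsum_eq.symm
  exact htsum ▸ hsum.hasSum

end CompletelyMonotone

/-! ### Bernstein's theorem -/

/-- The Laplace transform of a measure on `[0, ∞)`, for real arguments. It is only meaningful where
the integrand is integrable, e.g. at `x ≥ 0` for a finite measure. -/
noncomputable def laplace (σ : Measure ℝ≥0) (x : ℝ) : ℝ := ∫ t, Real.exp (-(x * (t : ℝ))) ∂σ

theorem exp_neg_mul_le_one {x : ℝ} (hx : 0 ≤ x) (t : ℝ≥0) : Real.exp (-(x * t)) ≤ 1 :=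
  Real.exp_le_one_iff.2 (neg_nonpos.2 (mul_nonneg hx t.2))

theorem norm_exp_neg_mul_le_one {x : ℝ} (hx : 0 ≤ x) (t : ℝ≥0) : ‖Real.exp (-(x * t))‖ ≤ 1 := by
  rw [Real.norm_of_nonneg (Real.exp_pos _).le]
  exact exp_neg_mul_le_one hx t

theorem integrable_exp_neg_mul (σ : Measure ℝ≥0) [IsFiniteMeasure σ] {x : ℝ} (hx : 0 ≤ x) :
    Integrable (fun t : ℝ≥0 => Real.exp (-(x * t))) σ :=
  .of_bound (by fun_prop) 1 (.of_forall (norm_exp_neg_mul_le_one hx))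

theorem laplace_zero (σ : Measure ℝ≥0) [IsProbabilityMeasure σ] : laplace σ 0 = 1 := by
  simp [laplace]

theorem exists_probabilityMeasure_hasSum_laplace {p : ℕ → ℝ} (hp : ∀ n, 0 ≤ p n)
    (hsum : HasSum p 1) (t : ℕ → ℝ≥0) :
    ∃ μ : ProbabilityMeasure ℝ≥0, ∀ x ≥ 0,
      HasSum (fun n => p n * Real.exp (-(x * t n))) (laplace μ x) := by
  let μ : Measure ℝ≥0 := .sum fun n => ENNReal.ofReal (p n) • .dirac (t n)
  have hμ : IsProbabilityMeasure μ := by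
    constructor
    simp only [μ, Measure.sum_apply _ MeasurableSet.univ, Measure.smul_apply, measure_univ,
      smul_eq_mul, mul_one]
    rw [← ENNReal.ofReal_tsum_of_nonneg hp hsum.summable, hsum.tsum_eq, ENNReal.ofReal_one]
  refine ⟨⟨μ, hμ⟩, fun x hx => ?_⟩
  have h := hasSum_integral_measure (integrable_exp_neg_mul μ hx)
  simp only [integral_smul_measure, integral_dirac, ENNReal.toReal_ofReal (hp _), smul_eq_mul] at h
  exact h

theorem mul_measureReal_le_one_sub_laplace (μ : Measure ℝ≥0) [IsProbabilityMeasure μ] {x : ℝ}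
    (hx : 0 ≤ x) : (1 - Real.exp (-1)) * μ.real {t | 1 ≤ x * t} ≤ 1 - laplace μ x := by
  have hint := integrable_exp_neg_mul μ hx
  have hset : {t : ℝ≥0 | 1 ≤ x * t} = {t : ℝ≥0 | 1 - Real.exp (-1) ≤ 1 - Real.exp (-(x * t))} := by
    simp only [sub_le_sub_iff_left, Real.exp_le_exp, neg_le_neg_iff]
  have h := mul_meas_ge_le_integral_of_nonneg
    (.of_forall fun t => sub_nonneg.2 (exp_neg_mul_le_one hx t))
    ((integrable_const 1).sub hint) (1 - Real.exp (-1))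
  rw [hset, laplace]
  simpa only [integral_sub (integrable_const 1) hint, integral_const, probReal_univ, smul_eq_mul,
    mul_one] using h

theorem isTightMeasureSet_of_one_sub_le_laplace {S : Set (Measure ℝ≥0)}
    (hS : ∀ μ ∈ S, IsProbabilityMeasure μ)
    (h : ∀ ε > 0, ∃ δ > 0, ∀ μ ∈ S, 1 - ε ≤ laplace μ δ) : IsTightMeasureSet S := by
  rw [isTightMeasureSet_iff_exists_isCompact_measure_compl_le]
  intro ε hε
  obtain ⟨r, hr0, hrε⟩ := ENNReal.lt_iff_exists_nnreal_btwn.1 hε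
  have hc : 0 < 1 - Real.exp (-1) := by simp
  obtain ⟨δ, hδ, hle⟩ := h ((1 - Real.exp (-1)) * r) (mul_pos hc (mod_cast hr0))
  refine ⟨Icc 0 δ⁻¹.toNNReal, isCompact_Icc, fun μ hμ => le_trans ?_ hrε.le⟩
  have := hS μ hμ
  have hsub : (Icc 0 δ⁻¹.toNNReal)ᶜ ⊆ {t : ℝ≥0 | 1 ≤ δ * t} := by
    intro t ht
    have : δ⁻¹ < t := by simpa [Real.toNNReal_lt_iff_lt_coe, hδ.le] using ht
    exact ((inv_lt_iff_one_lt_mul₀' hδ).1 this).le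
  have hreal : μ.real {t : ℝ≥0 | 1 ≤ δ * t} ≤ r := by
    refine le_of_mul_le_mul_left ((mul_measureReal_le_one_sub_laplace μ hδ.le).trans ?_) hc
    linarith [hle μ hμ]
  calc μ (Icc 0 δ⁻¹.toNNReal)ᶜ ≤ μ {t : ℝ≥0 | 1 ≤ δ * t} := measure_mono hsub
    _ = ENNReal.ofReal (μ.real {t : ℝ≥0 | 1 ≤ δ * t}) := (ofReal_measureReal).symm
    _ ≤ r := ENNReal.ofReal_le_of_le_toReal hreal

theorem tendsto_laplace {ι : Type*} {l : Filter ι} {μ : ι → ProbabilityMeasure ℝ≥0}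
    {σ : ProbabilityMeasure ℝ≥0} (h : Tendsto μ l (𝓝 σ)) {x : ℝ} (hx : 0 ≤ x) :
    Tendsto (fun i => laplace (μ i) x) l (𝓝 (laplace σ x)) :=
  ProbabilityMeasure.tendsto_iff_forall_integral_tendsto.1 h
    (.ofNormedAddCommGroup _ (by fun_prop) 1 (norm_exp_neg_mul_le_one hx))

theorem exists_laplace_eq_of_tendsto {μ : ℕ → ProbabilityMeasure ℝ≥0} {f : ℝ → ℝ}
    (htight : ∀ ε > 0, ∃ δ > 0, ∀ n, 1 - ε ≤ laplace (μ n) δ)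
    (hlim : ∀ x > 0, Tendsto (fun n => laplace (μ n) x) atTop (𝓝 (f x))) :
    ∃ σ : ProbabilityMeasure ℝ≥0, ∀ x > 0, f x = laplace σ x := by
  have hcompact : IsCompact (closure (range μ)) := by
    refine isCompact_closure_of_isTightMeasureSet (isTightMeasureSet_of_one_sub_le_laplace ?_ ?_)
    · rintro _ ⟨ν, -, rfl⟩
      infer_instance
    · simpa using htight
  obtain ⟨σ, -, φ, hφ, hσ⟩ :=
    hcompact.isSeqCompact fun n => subset_closure (mem_range_self n)
  exact ⟨σ, fun x hx => tendsto_nhds_unique ((hlim x hx).comp hφ.tendsto_atTop)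
    (tendsto_laplace hσ hx.le)⟩

theorem tendsto_mul_one_sub_exp_neg_div_atTop (x : ℝ) :
    Tendsto (fun a => a * (1 - Real.exp (-(x / a)))) atTop (𝓝 x) := by
  have hderiv : HasDerivAt (fun y => -Real.exp (-(x * y))) x 0 := by
    simpa using ((hasDerivAt_id (0 : ℝ)).const_mul x).fun_neg.exp.fun_neg
  refine (hderiv.tendsto_slope_zero_right.comp tendsto_inv_atTop_nhdsGT_zero).congr fun a => ?_
  simp [div_eq_mul_inv, neg_add_eq_sub]

theorem mul_one_sub_exp_neg_div_le {a : ℝ} (ha : 0 < a) (x : ℝ) :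
    a * (1 - Real.exp (-(x / a))) ≤ x := by
  have h := Real.one_sub_le_exp_neg (x / a)
  calc a * (1 - Real.exp (-(x / a))) ≤ a * (x / a) := by gcongr; linarith
    _ = x := mul_div_cancel₀ x ha.ne'

namespace CompletelyMonotone

variable {f : ℝ → ℝ} (hf : CompletelyMonotone f) (hlim : Tendsto f (𝓝[>] 0) (𝓝 1))

include hf hlim

theorem exists_laplace_eq_comp {a : ℝ} (ha : 0 < a) :
    ∃ μ : ProbabilityMeasure ℝ≥0, ∀ x > 0,
      laplace μ x = f (a * (1 - Real.exp (-(x / a)))) := by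
  obtain ⟨μ, hμ⟩ := exists_probabilityMeasure_hasSum_laplace (hf.taylorWeight_nonneg ha)
    (hf.hasSum_taylorWeight hlim ha) fun k => k / a.toNNReal
  refine ⟨μ, fun x hx => (hμ x hx.le).unique ?_⟩
  have hexp : Real.exp (-(x / a)) < 1 := Real.exp_lt_one_iff.2 (neg_neg_of_pos (div_pos hx ha))
  convert hf.hasSum_taylorWeight_mul_pow (fun _ => hf.le_of_tendsto_nhdsGT_zero hlim) ha
    (Real.exp_pos _) hexp using 3 with k
  rw [← Real.exp_nat_mul]
  congr 1
  push_cast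
  rw [Real.coe_toNNReal a ha.le]
  ring

theorem exists_laplace_eq : ∃ σ : ProbabilityMeasure ℝ≥0, ∀ x > 0, f x = laplace σ x := by
  choose μ hμ using fun n : ℕ => hf.exists_laplace_eq_comp hlim (Nat.cast_add_one_pos (α := ℝ) n)
  refine exists_laplace_eq_of_tendsto (μ := μ) (fun ε hε => ?_) fun x hx => ?_
  · obtain ⟨δ, hδε, hδ⟩ :=
      ((hlim.eventually_const_le (sub_lt_self 1 hε)).and self_mem_nhdsWithin).exists
    refine ⟨δ, hδ, fun n => hδε.trans ?_⟩
    have ha : (0 : ℝ) < n + 1 := by positivity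
    have hpos : 0 < 1 - Real.exp (-(δ / (n + 1))) :=
      sub_pos.2 (Real.exp_lt_one_iff.2 (neg_neg_of_pos (div_pos hδ ha)))
    rw [hμ n δ hδ]
    exact hf.antitoneOn (mul_pos ha hpos) hδ (mul_one_sub_exp_neg_div_le ha δ)
  · simp only [hμ _ x hx]
    have hcont : ContinuousAt f x := hf.contDiffOn.continuousOn.continuousAt (Ioi_mem_nhds hx)
    exact hcont.tendsto.comp <| (tendsto_mul_one_sub_exp_neg_div_atTop x).comp <|
      tendsto_atTop_add_const_right _ 1 tendsto_natCast_atTop_atTop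

end CompletelyMonotone

/-! ### Scalar autonomous equations -/

theorem surjective_of_le_deriv {T : ℝ → ℝ} (hT : Differentiable ℝ T) {C : ℝ} (hC : 0 < C)
    (hderiv : ∀ v, C ≤ deriv T v) : Function.Surjective T := by
  have hgrowth : ∀ ⦃v w⦄, v ≤ w → C * (w - v) ≤ T w - T v :=
    mul_sub_le_image_sub_of_le_deriv hT hderiv
  refine hT.continuous.surjective
    (tendsto_atTop_mono' (f₁ := fun v => T 0 + C * v) _ ?_
      (tendsto_atTop_add_const_left _ _ (tendsto_id.const_mul_atTop hC)))
    (tendsto_atBot_mono' (f₁ := fun v => T 0 + C * v) _ ?_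
      (tendsto_atBot_add_const_left _ _ (tendsto_id.const_mul_atBot hC)))
  · filter_upwards [eventually_ge_atTop 0] with v hv
    linarith [hgrowth hv]
  · filter_upwards [eventually_le_atBot 0] with v hv
    linarith [hgrowth hv]

theorem exists_hasDerivAt_comp_self {h : ℝ → ℝ} (hh : Continuous h) (hpos : ∀ y, 0 < h y) {M : ℝ}
    (hM : ∀ y, h y ≤ M) (c : ℝ) : ∃ y : ℝ → ℝ, y 0 = c ∧ ∀ x, HasDerivAt y (h (y x)) x := by
  -- Separation of variables: `y` is the inverse of `T`.
  let T : ℝ → ℝ := fun v => ∫ w in c..v, (h w)⁻¹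
  have hT : ∀ v, HasDerivAt T (h v)⁻¹ v := fun v =>
    ((hh.inv₀ fun y => (hpos y).ne').integral_hasStrictDerivAt c v).hasDerivAt
  have hmono : StrictMono T := strictMono_of_deriv_pos fun v => by
    rw [(hT v).deriv]
    exact inv_pos.2 (hpos v)
  have hsurj : Function.Surjective T :=
    surjective_of_le_deriv (fun v => (hT v).differentiableAt)
      (inv_pos.2 ((hpos c).trans_le (hM c))) fun v => by
      rw [(hT v).deriv]
      exact inv_anti₀ (hpos v) (hM v)
  let e := hmono.orderIsoOfSurjective T hsurj
  refine ⟨e.symm, e.symm_apply_eq.2 intervalIntegral.integral_same.symm, fun x => ?_⟩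
  have hinv : HasDerivAt e.symm (h (e.symm x))⁻¹⁻¹ x :=
    (hT (e.symm x)).of_local_left_inverse e.symm.continuous.continuousAt
      (inv_ne_zero (hpos _).ne') (.of_forall e.apply_symm_apply)
  rwa [inv_inv] at hinv

theorem exists_strictMono_hasDerivAt_comp_self {g : ℝ → ℝ} (hg : ContinuousOn g (Ico 0 1))
    (hpos : ∀ v ∈ Ico (0 : ℝ) 1, 0 < g v) {M : ℝ} (hM : ∀ v ∈ Ico (0 : ℝ) 1, g v ≤ M * (1 - v)) :
    ∃ F : ℝ → ℝ, F 0 = 0 ∧ StrictMono F ∧ (∀ x, F x < 1) ∧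
      ∀ x ≥ 0, HasDerivAt F (g (F x)) x := by
  -- The substitution `F = 1 - exp (-y)` moves the equilibrium `1` to infinity; truncating `y` at
  -- `0` makes the right-hand side of the equation for `y` continuous on the whole line.
  let u : ℝ → ℝ := fun y => 1 - Real.exp (-max y 0)
  have hu : ∀ y, u y ∈ Ico 0 1 := fun y => ⟨by simp [u], by simp [u, Real.exp_pos]⟩
  have hpos' : ∀ y, 0 < Real.exp (max y 0) * g (u y) := fun y =>
    mul_pos (Real.exp_pos _) (hpos _ (hu y))
  have hM' : ∀ y, Real.exp (max y 0) * g (u y) ≤ M := fun y =>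
    (mul_le_mul_of_nonneg_left (hM _ (hu y)) (Real.exp_pos _).le).trans_eq <| by
      simp [u, mul_left_comm, ← Real.exp_add]
  obtain ⟨y, hy0, hy⟩ := exists_hasDerivAt_comp_self
    (h := fun y => Real.exp (max y 0) * g (u y))
    (.mul (by fun_prop) (hg.comp_continuous (by fun_prop) hu)) hpos' hM' 0
  have hmono : StrictMono y := strictMono_of_deriv_pos fun x => (hy x).deriv ▸ hpos' (y x)
  refine ⟨fun x => 1 - Real.exp (-y x), by simp [hy0], fun x₁ x₂ hx => ?_,
    fun x => sub_lt_self 1 (Real.exp_pos _), fun x hx => ?_⟩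
  · simpa using hmono hx
  · have hyx : 0 ≤ y x := hy0 ▸ hmono.monotone hx
    have hF := ((hy x).fun_neg.exp).const_sub 1
    simp only [u, max_eq_left hyx] at hF
    rwa [mul_neg, neg_neg, ← mul_assoc, ← Real.exp_add, neg_add_cancel, Real.exp_zero,
      one_mul] at hF

theorem eqOn_Ici_of_antitoneOn {h F G : ℝ → ℝ} {s : Set ℝ} {a : ℝ} (hh : AntitoneOn h s)
    (hF : ∀ x ∈ Ici a, HasDerivWithinAt F (h (F x)) (Ici a) x) (hFs : MapsTo F (Ici a) s)
    (hG : ∀ x ∈ Ici a, HasDerivWithinAt G (h (G x)) (Ici a) x) (hGs : MapsTo G (Ici a) s)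
    (ha : F a = G a) : EqOn F G (Ici a) := by
  have hderiv : ∀ x ∈ Ici a, HasDerivWithinAt (fun x => (F x - G x) ^ 2)
      (2 * ((F x - G x) * (h (F x) - h (G x)))) (Ici a) x := fun x hx => by
    simpa [mul_assoc] using ((hF x hx).fun_sub (hG x hx)).fun_pow 2
  have hanti : AntitoneOn (fun x => (F x - G x) ^ 2) (Ici a) := by
    refine antitoneOn_of_hasDerivWithinAt_nonpos (convex_Ici a)
      (fun x hx => (hderiv x hx).continuousWithinAt)
      (fun x hx => (hderiv x (interior_subset hx)).mono interior_subset) fun x hx => ?_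
    have hx' := interior_subset hx
    have : (F x - G x) * (h (F x) - h (G x)) ≤ 0 := by
      rcases le_total (F x) (G x) with hle | hle
      · exact mul_nonpos_of_nonpos_of_nonneg (sub_nonpos.2 hle)
          (sub_nonneg.2 (hh (hFs hx') (hGs hx') hle))
      · exact mul_nonpos_of_nonneg_of_nonpos (sub_nonneg.2 hle)
          (sub_nonpos.2 (hh (hGs hx') (hFs hx') hle))
    linarith
  intro x hx
  have hle : (F x - G x) ^ 2 ≤ 0 := by simpa [ha] using hanti self_mem_Ici hx hx
  exact sub_eq_zero.1 (pow_eq_zero_iff two_ne_zero |>.1 (hle.antisymm (sq_nonneg _)))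

/-! ### The profile function -/

namespace IsProfileFunction

variable {α : ℝ} {F G : ℝ → ℝ}

theorem continuousOn (hF : IsProfileFunction α F) : ContinuousOn F (Ici 0) := fun x hx =>
  (hF.hasDeriv x hx).continuousWithinAt

theorem nonneg (hF : IsProfileFunction α F) (hα : α ≠ 0) {x : ℝ} (hx : 0 ≤ x) : 0 ≤ F x :=
  image_le_of_deriv_right_lt_deriv_boundary' (f := fun _ => 0) (f' := fun _ => 0)
    (B' := fun y => 1 - F y ^ α) continuousOn_const (fun _ _ => hasDerivWithinAt_const _ _ _)
    hF.map_zero.ge (hF.continuousOn.mono Icc_subset_Ici_self)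
    (fun y hy => (hF.hasDeriv y hy.1).mono (Ici_subset_Ici.2 hy.1))
    (fun y _ hy => by simp [← hy, Real.zero_rpow hα]) (right_mem_Icc.2 hx)

theorem eqOn (hF : IsProfileFunction α F) (hG : IsProfileFunction α G) (hα : 0 < α) :
    EqOn F G (Ici 0) :=
  eqOn_Ici_of_antitoneOn (h := fun v => 1 - v ^ α) (s := Ici 0)
    (fun _ hv _ _ hvw => sub_le_sub_left (Real.rpow_le_rpow hv hvw hα.le) 1)
    hF.hasDeriv (fun _ => hF.nonneg hα.ne') hG.hasDeriv (fun _ => hG.nonneg hα.ne')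
    (hF.map_zero.trans hG.map_zero.symm)

end IsProfileFunction

theorem exists_strictMono_hasDerivAt_one_sub_rpow {α : ℝ} (hα0 : 0 < α) (hα1 : α ≤ 1) :
    ∃ F : ℝ → ℝ, F 0 = 0 ∧ StrictMono F ∧ (∀ x, F x < 1) ∧
      ∀ x ≥ 0, HasDerivAt F (1 - F x ^ α) x :=
  exists_strictMono_hasDerivAt_comp_self (M := 1)
    (continuousOn_const.sub (continuousOn_id.rpow_const fun _ _ => .inr hα0.le))
    (fun _ hv => sub_pos.2 (Real.rpow_lt_one hv.1 hv.2 hα0)) fun v hv => by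
      rw [one_mul]
      exact sub_le_sub_left (Real.self_le_rpow_of_le_one hv.1 hv.2.le hα1) 1

theorem hasDerivAt_rpow_neg_mul_one_sub_rpow_pow {α x : ℝ} {F : ℝ → ℝ} (hx : 0 < F x)
    (hF : HasDerivAt F (1 - F x ^ α) x) (b : ℝ) (j : ℕ) :
    HasDerivAt (fun x => F x ^ (-b) * (1 - F x ^ α) ^ j)
      (-(b * (F x ^ (-(b + 1)) * (1 - F x ^ α) ^ (j + 1)) +
        j * α * (F x ^ (-(b + 1 - α)) * (1 - F x ^ α) ^ j))) x := by
  have hneg := hF.rpow_const (p := -b) (.inl hx.ne')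
  have hpow := ((hF.rpow_const (p := α) (.inl hx.ne')).const_sub 1).fun_pow j
  refine (hneg.fun_mul hpow).congr_deriv ?_
  have hb : F x ^ (-(b + 1)) = F x ^ (-b - 1) := by ring_nf
  have hbα : F x ^ (-(b + 1 - α)) = F x ^ (-b) * F x ^ (α - 1) := by
    rw [← Real.rpow_add hx]
    ring_nf
  rw [hb, hbα]
  rcases j with _ | j
  · simp only [Nat.cast_zero, zero_mul, mul_zero, add_zero, zero_add, pow_zero, mul_one, pow_one]
    ring
  · push_cast
    ring

theorem completelyMonotone_one_sub {α : ℝ} (hα0 : 0 ≤ α) (hα1 : α ≤ 1) {F : ℝ → ℝ}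
    (hFmem : ∀ x > 0, F x ∈ Ioo 0 1) (hF : ∀ x > 0, HasDerivAt F (1 - F x ^ α) x) :
    CompletelyMonotone fun x => 1 - F x := by
  let e : ℝ≥0 × ℕ → ℝ → ℝ := fun p x => F x ^ (-(p.1 : ℝ)) * (1 - F x ^ α) ^ p.2
  let S : Set (ℝ → ℝ) := insert (fun x => 1 - F x) (range e)
  have he : ∀ p, e p ∈ Submodule.span ℝ≥0 S := fun p =>
    Submodule.subset_span (mem_insert_of_mem _ (mem_range_self p))
  refine .of_mem_span_of_neg_deriv_mem_span (S := S) ?_ ?_ (Submodule.subset_span (mem_insert _ _))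
  · rintro _ (rfl | ⟨p, rfl⟩) x hx
    · exact sub_nonneg.2 (hFmem x hx).2.le
    · exact mul_nonneg (Real.rpow_nonneg (hFmem x hx).1.le _)
        (pow_nonneg (sub_nonneg.2 (Real.rpow_le_one (hFmem x hx).1.le (hFmem x hx).2.le hα0)) _)
  · rintro _ (rfl | ⟨⟨b, j⟩, rfl⟩)
    · refine ⟨e (0, 1), he _, fun x hx => ?_⟩
      simpa [e] using (hF x hx).const_sub 1
    · let a : ℝ≥0 := ⟨α, hα0⟩
      refine ⟨b • e (b + 1, j + 1) + (j * a) • e (b + (1 - a), j),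
        add_mem (Submodule.smul_mem _ _ (he _)) (Submodule.smul_mem _ _ (he _)), fun x hx => ?_⟩
      have ha : ((1 - a : ℝ≥0) : ℝ) = 1 - α := NNReal.coe_sub hα1
      simpa [e, ha, NNReal.smul_def, show (a : ℝ) = α from rfl, add_sub_assoc] using
        hasDerivAt_rpow_neg_mul_one_sub_rpow_pow (hFmem x hx).1 (hF x hx) b j

theorem corollary4p2 (α : ℝ) (hα0 : 0 < α) (hα1 : α ≤ 1) :
    (∃ F : ℝ → ℝ, IsProfileFunction α F) ∧
    ∃ σ : Measure ℝ≥0, IsProbabilityMeasure σ ∧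
      ∀ F : ℝ → ℝ, IsProfileFunction α F →
        ∀ x : ℝ, 0 ≤ x → 1 - F x = ∫ t : ℝ≥0, Real.exp (-(x * (t : ℝ))) ∂σ := by
  obtain ⟨F, hF0, hmono, hlt, hF⟩ := exists_strictMono_hasDerivAt_one_sub_rpow hα0 hα1
  have hprofile : IsProfileFunction α F := ⟨hF0, fun x hx => (hF x hx).hasDerivWithinAt⟩
  have hcm : CompletelyMonotone fun x => 1 - F x :=
    completelyMonotone_one_sub hα0.le hα1 (fun x hx => ⟨hF0 ▸ hmono hx, hlt x⟩)
      fun x hx => hF x hx.le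
  have hlim : Tendsto (fun x => 1 - F x) (𝓝[>] 0) (𝓝 1) := by
    simpa [hF0] using
      ((hF 0 le_rfl).continuousAt.tendsto.const_sub 1).mono_left nhdsWithin_le_nhds
  obtain ⟨σ, hσ⟩ := hcm.exists_laplace_eq hlim
  refine ⟨⟨F, hprofile⟩, σ, inferInstance, fun G hG x hx => ?_⟩
  rw [hG.eqOn hprofile hα0 hx, ← laplace]
  rcases hx.eq_or_lt with rfl | hx
  · rw [hF0, sub_zero, laplace_zero]
  · exact hσ x hx
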